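/- Let $a\neq b$ be two letters and let $\alpha\in(0,1)$ be irrational with continued fraction expansion $\alpha=[0;d_0+1,d_1,d_2,\ldots]$, where $d_0>0$ (equivalently, $\alpha<1/2$). Define $s_{-1}=b$, $s_0=a$ and $s_{n+1}=s_n^{d_n}s_{n-1}$ for $n\ge 0$, and let $w=\lim_{n\to\infty} s_n$ be the standard Sturmian word of slope $\alpha$ (an infinite word starting with $a$). For $n\ge 0$ let $u_n$ be the element of the free group on $\{a,b\}$ with $s_n=u_n\xi_n\eta_n$, where $\xi_n\eta_n=ab$ if $n$ is odd and $\xi_n\eta_n=ba$ if $n$ is even; so $u_0=b^{-1}$, and $u_n$ is a word for $n\ge 1$. A finite word $z$ is called closed if it is empty or has a factor $t\neq z$ that occurs in $z$ exactly twice, as a prefix and as a suffix of $z$ (with no internal occurrence); otherwise $z$ is called open. Let $v$ be a finite word and $x$ a letter such that $vx$ is a prefix of $w$. Then: 1. $v$ is open and $vx$ is closed if and only if there exist $n\ge 1$ and a letter $y$ such that $xy=\xi_n\eta_n$ and $v=u_nxyu_n$; 2. $v$ is closed and $vx$ is open if and only if there exist $n\ge 0$ and a letter $y$ such that $xy=\xi_n\eta_n$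 and $v=u_nxyu_{n+1}=u_{n+1}yxu_n$ (equalities in the free group). -/

import Mathlib

/-- A finite word is closed if it is empty or has a factor `u`, different from the word itself, that
occurs in it exactly twice: as a prefix and as a suffix, with no internal occurrence. -/
def IsClosedWord {A : Type*} (v : List A) : Prop :=
  v = [] ∨ ∃ u : List A, u ≠ v ∧ u <+: v ∧ u <:+ v ∧
    ∀ p q : List A, v = p ++ u ++ q → p = [] ∨ q = []

/-- A word is open if it is not closed. -/
def IsOpenWord {A : Type*} (v : List A) : Prop := ¬ IsClosedWord v

/-- The finite word `v` is a prefix of the infinite word `w` (letters indexed from `0`). -/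
def IsPrefixOfInfinite {A : Type*} (v : List A) (w : ℕ → A) : Prop :=
  ∀ i : ℕ, ∀ h : i < v.length, v[i] = w i

/-- The finite words `s 0, s 1, …` converge to the infinite word `w`: each position of `s n` is
eventually defined and equal to the letter of `w` there. -/
def WordsConvergeTo {A : Type*} (s : ℕ → List A) (w : ℕ → A) : Prop :=
  ∀ i : ℕ, ∃ N : ℕ, ∀ n ≥ N, (s n)[i]? = some (w i)

/-- `[0; d 0 + 1, d 1, d 2, …]` is the (infinite) continued fraction expansion of `α`. -/
def HasContFracExpansion (α : ℝ) (d : ℕ → ℕ) : Prop :=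
  (GenContFract.of α).h = 0 ∧
  (GenContFract.of α).partDens.get? 0 = some ((d 0 : ℝ) + 1) ∧
  ∀ n : ℕ, (GenContFract.of α).partDens.get? (n + 1) = some (d (n + 1) : ℝ)

/-- The standard sequence with its index shifted by one: `shiftedStandardSeq a b d (n + 1)` is
`s_n` for `n ≥ -1`, where `s_{-1} = b`, `s_0 = a`, `s_{n+1} = s_n ^ (d n) s_{n-1}`. -/
def shiftedStandardSeq {A : Type*} (a b : A) (d : ℕ → ℕ) : ℕ → List A
  | 0 => [b]
  | 1 => [a]
  | n + 2 => (List.replicate (d n) (shiftedStandardSeq a b d (n + 1))).flatten ++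
      shiftedStandardSeq a b d n

/-- The word `s_n`, `n ≥ 0`, of the standard sequence. -/
def standardSeq {A : Type*} (a b : A) (d : ℕ → ℕ) (n : ℕ) : List A :=
  shiftedStandardSeq a b d (n + 1)

/-- `w` is the standard Sturmian word of slope `α`, where `0 < α < 1` is irrational with continued
fraction expansion `[0; d 0 + 1, d 1, …]`: the limit of the standard sequence. -/
structure IsStandardSturmian {A : Type*} (a b : A) (α : ℝ) (d : ℕ → ℕ) (w : ℕ → A) : Prop where
  irrational : Irrational α
  pos : 0 < α
  lt_one : α < 1
  expansion : HasContFracExpansion α d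
  converges : WordsConvergeTo (standardSeq a b d) w

/-- The two letters `(x, y)` with `xy = ab` if `n` is odd and `xy = ba` if `n` is even. -/
def endLetters {A : Type*} (a b : A) (n : ℕ) : A × A :=
  if Odd n then (a, b) else (b, a)

/-- A finite word as an element of the free group on the alphabet. -/
def wordInFreeGroup {A : Type*} (v : List A) : FreeGroup A :=
  (v.map FreeGroup.of).prod

/-- `u_n`, the element of the free group with `s_n = u_n x y`, where `(x, y) = endLetters a b n`.
Thus `u_0 = b⁻¹`, and if `d 0 > 0` then `u_n` is a word for `n ≥ 1`. -/
def centralSeq {A : Type*} (a b : A) (d : ℕ → ℕ) (n : ℕ) : FreeGroup A :=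
  wordInFreeGroup (standardSeq a b d n) *
    (FreeGroup.of (endLetters a b n).1 * FreeGroup.of (endLetters a b n).2)⁻¹

/-! A nonempty prefix of `w` is closed exactly when its length is `k + r`, with `r` the first return
of the prefix of length `k`. Write `q_n = |s_n|`. For `q_n - 1 ≤ k ≤ q_{n+1} - 2` this return is
`q_n`: `s_{n+1} s_n` and `s_n s_{n+1}` differ only in their last two letters, so the prefix recurs
there (`prefixOccursAt_length_standardSeq`), and coprimality of `q_n` with the number of `a`s in
`s_n` forbids an earlier return (`not_prefixOccursAt_of_lt`). Hence the positive closed lengths fill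
the intervals `[2 q_n - 1, q_n + q_{n+1} - 2]`, which are separated by gaps because `q_n < q_{n+1}`.
The transitions are the ends of these intervals. As a prefix is determined by its length, it remains
to compute the prefixes of those lengths; exponent sums recover the lengths from the free-group
equations. -/

/-! ### Closed prefixes and first returns -/

section ClosedPrefixes

variable {A : Type*}

/-- The prefix of length `L` of the infinite word `w`. -/
def infinitePrefix (w : ℕ → A) (L : ℕ) : List A := (List.range L).map w

/-- The prefix of length `k` of `w` occurs in `w` at position `i`. -/
def PrefixOccursAt (w : ℕ → A) (k i : ℕ) : Prop := ∀ j < k, w (i + j) = w j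

theorem length_infinitePrefix (w : ℕ → A) (L : ℕ) : (infinitePrefix w L).length = L := by
  simp [infinitePrefix]

theorem IsPrefixOfInfinite.eq_infinitePrefix {v : List A} {w : ℕ → A}
    (h : IsPrefixOfInfinite v w) : v = infinitePrefix w v.length := by
  apply List.ext_getElem
  · simp [infinitePrefix]
  · intro i h₁ h₂
    simp [infinitePrefix, h i h₁]

theorem IsPrefixOfInfinite.of_prefix {u v : List A} {w : ℕ → A}
    (h : IsPrefixOfInfinite v w) (huv : u <+: v) : IsPrefixOfInfinite u w := by
  intro i hi
  rw [← h i (hi.trans_le huv.length_le), huv.getElem hi]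

theorem IsPrefixOfInfinite.eq_of_length_eq {u v : List A} {w : ℕ → A}
    (hu : IsPrefixOfInfinite u w) (hv : IsPrefixOfInfinite v w) (h : u.length = v.length) :
    u = v := by
  rw [hu.eq_infinitePrefix, hv.eq_infinitePrefix, h]

/-- Translates factorisations of a prefix into conditions on positions in `w`. -/
theorem infinitePrefix_eq_append_iff (w : ℕ → A) (L : ℕ) (p u q : List A) :
    infinitePrefix w L = p ++ u ++ q ↔
      L = p.length + u.length + q.length ∧ (∀ j (h : j < p.length), p[j] = w j) ∧
      (∀ j (h : j < u.length), u[j] = w (p.length + j)) ∧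
      ∀ j (h : j < q.length), q[j] = w (p.length + u.length + j) := by
  have key : ∀ n : ℕ, ∀ l : List A, ∀ m, l.length = m →
      ((List.range' n m).map w = l ↔ ∀ j (h : j < l.length), l[j] = w (n + j)) := by
    intro n l m hm
    constructor
    · rintro rfl j h
      simp
    · intro h
      apply List.ext_getElem
      · simp [hm]
      · intro i h₁ h₂
        simp [h i h₂]
  constructor
  · intro h
    have hL : L = p.length + u.length + q.length := by
      simpa [infinitePrefix, add_assoc] using congrArg List.length h
    refine ⟨hL, ?_⟩
    rw [infinitePrefix, List.range_eq_range', hL, ← List.range'_append_1,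
      ← List.range'_append_1, List.map_append, List.map_append] at h
    obtain ⟨h₁, h₂⟩ := List.append_inj' h (by simp)
    obtain ⟨h₃, h₄⟩ := List.append_inj' h₁ (by simp)
    refine ⟨by simpa using (key _ p _ rfl).1 h₃, by simpa using (key _ u _ rfl).1 h₄,
      by simpa using (key _ q _ rfl).1 h₂⟩
  · rintro ⟨hL, h₁, h₂, h₃⟩
    rw [infinitePrefix, List.range_eq_range', hL, ← List.range'_append_1,
      ← List.range'_append_1, List.map_append, List.map_append,
      (key _ p _ rfl).2 (by simpa using h₁), (key _ u _ rfl).2 (by simpa using h₂),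
      (key _ q _ rfl).2 (by simpa using h₃)]

/-- A nonempty prefix is closed iff it is a prefix of length `k` completed up to the end of its
first return, at position `r`. -/
theorem isClosedWord_infinitePrefix_iff (w : ℕ → A) (L : ℕ) :
    IsClosedWord (infinitePrefix w L) ↔ L = 0 ∨ ∃ k r, L = k + r ∧ 0 < r ∧
      PrefixOccursAt w k r ∧ ∀ i, 0 < i → i < r → ¬ PrefixOccursAt w k i := by
  have hnil : infinitePrefix w L = [] ↔ L = 0 := by simp [infinitePrefix]
  unfold IsClosedWord
  rw [hnil]
  refine or_congr Iff.rfl ⟨?_, ?_⟩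
  · rintro ⟨u, hne, ⟨q, hq⟩, ⟨p, hp⟩, hint⟩
    have h₁ := (infinitePrefix_eq_append_iff w L [] u q).1 (by simpa using hq.symm)
    have h₂ := (infinitePrefix_eq_append_iff w L p u []).1 (by simpa using hp.symm)
    have hu : ∀ j (h : j < u.length), u[j] = w j := by simpa using h₁.2.2.1
    have hpos : 0 < p.length := by
      rw [List.length_pos_iff]
      rintro rfl
      exact hne (by simpa using hp)
    have hL : L = p.length + u.length := by simpa using h₂.1
    refine ⟨u.length, p.length, by omega, hpos, fun j hj => ?_, fun i hi hir hocc => ?_⟩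
    · rw [← h₂.2.2.1 j hj, hu j hj]
    · have := hint (infinitePrefix w i)
        ((List.range (p.length - i)).map fun j => w (i + u.length + j)) (by
          rw [infinitePrefix_eq_append_iff]
          refine ⟨by simp [infinitePrefix]; omega, by simp [infinitePrefix], ?_,
            by simp [infinitePrefix]⟩
          intro j hj
          rw [length_infinitePrefix, hocc j hj, hu j hj])
      rcases this with h | h
      · simp [infinitePrefix] at h; omega
      · simp at h; omega
  · rintro ⟨k, r, rfl, hr, hocc, hfirst⟩
    refine ⟨infinitePrefix w k, ?_, ?_, ?_, ?_⟩
    · intro h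
      have := congrArg List.length h
      simp only [length_infinitePrefix] at this
      omega
    · refine ⟨(List.range r).map fun j => w (k + j), Eq.symm ?_⟩
      have := (infinitePrefix_eq_append_iff w (k + r) [] (infinitePrefix w k)
        ((List.range r).map fun j => w (k + j))).2 (by simp [infinitePrefix])
      simpa using this
    · refine ⟨infinitePrefix w r, Eq.symm ?_⟩
      have := (infinitePrefix_eq_append_iff w (k + r) (infinitePrefix w r)
        (infinitePrefix w k) []).2 (by
          refine ⟨by simp [infinitePrefix, add_comm], by simp [infinitePrefix], ?_, by simp⟩
          intro j hj
          rw [length_infinitePrefix] at hj ⊢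
          rw [hocc j hj]
          simp [infinitePrefix])
      simpa using this
    · intro p q h
      rw [infinitePrefix_eq_append_iff] at h
      obtain ⟨hL, -, hu, -⟩ := h
      rw [length_infinitePrefix] at hL
      by_contra! hne
      have hp := List.length_pos_iff.2 hne.1
      have hq := List.length_pos_iff.2 hne.2
      refine hfirst p.length hp (by omega) fun j hj => ?_
      rw [← hu j (by rwa [length_infinitePrefix])]
      simp [infinitePrefix]

end ClosedPrefixes

/-! ### Sums of periodic sequences -/

section PeriodicCounts

open Finset

theorem sum_range_add_of_periodic {c : ℕ → ℕ} {q : ℕ} (hc : ∀ j, c (j + q) = c j) (i : ℕ) :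
    ∑ j ∈ range q, c (j + i) = ∑ j ∈ range q, c j := by
  induction i with
  | zero => simp
  | succ i ih =>
    have h₁ := sum_range_succ (fun j => c (j + i)) q
    have h₂ := sum_range_succ' (fun j => c (j + i)) q
    have h₃ : c (q + i) = c i := by rw [add_comm, hc]
    simp only [zero_add] at h₂
    have h₄ : ∀ j, j + 1 + i = j + (i + 1) := fun j => by ring
    simp only [h₄] at h₂
    omega

theorem sum_range_mul_of_periodic {c : ℕ → ℕ} {q : ℕ} (hc : ∀ j, c (j + q) = c j) (m : ℕ) :
    ∑ j ∈ range (m * q), c j = m * ∑ j ∈ range q, c j := by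
  induction m with
  | zero => simp
  | succ m ih =>
    rw [add_mul, one_mul, sum_range_add, ih, add_mul, one_mul]
    congr 1
    simpa [add_comm] using sum_range_add_of_periodic hc (m * q)

/-- A `q`-periodic sequence whose sum over a period is coprime to `q` agrees on `q - 1` consecutive
places only with its shifts by multiples of `q`. -/
theorem dvd_shift_of_coprime_sum {c : ℕ → ℕ} {q i : ℕ} (hq : 0 < q)
    (hc : ∀ j, c (j + q) = c j) (hcop : Nat.Coprime q (∑ j ∈ range q, c j))
    (hi : ∀ j < q - 1, c (j + i) = c j) : q ∣ i := by
  -- All windows of length `q` have the same sum, which forces the one place not covered by `hi`.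
  have hlast : c (q - 1 + i) = c (q - 1) := by
    have h := sum_range_add_of_periodic hc i
    obtain ⟨p, rfl⟩ : ∃ p, q = p + 1 := ⟨q - 1, by omega⟩
    rw [sum_range_succ, sum_range_succ,
      sum_congr rfl fun j hj => hi j (by simpa using hj)] at h
    simpa using h
  have hmod : ∀ j, c (j % q) = c j := by
    intro j
    exact Function.Periodic.map_mod_nat hc j
  have hper : ∀ j, c (j + i) = c j := by
    intro j
    have h₁ : c (j % q + i) = c (j % q) := by
      have := Nat.mod_lt j hq
      by_cases h : j % q < q - 1
      · exact hi _ h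
      · rw [show j % q = q - 1 by omega, hlast]
    rw [← hmod (j + i), ← Nat.mod_add_mod, hmod, h₁, hmod]
  -- The first `i * q` terms are summed in two ways, by blocks of length `q` and of length `i`.
  have h₁ := sum_range_mul_of_periodic hc i
  have h₂ := sum_range_mul_of_periodic hper q
  rw [mul_comm, h₂] at h₁
  exact hcop.dvd_of_dvd_mul_right ⟨_, h₁.symm⟩

end PeriodicCounts

/-! ### Combinatorics of the words `s_n` -/

section StandardSequence

variable {A : Type*} {a b : A} {d : ℕ → ℕ}

theorem HasContFracExpansion.pos {α : ℝ} (h : HasContFracExpansion α d) (hd : 0 < d 0) (n : ℕ) :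
    0 < d n := by
  cases n with
  | zero => exact hd
  | succ n =>
    -- At index `0` this bound would only give `1 ≤ d 0 + 1`, hence the hypothesis `hd`.
    have := GenContFract.of_one_le_get?_partDen (h.2.2 n)
    exact_mod_cast this

theorem shiftedStandardSeq_add_two (a b : A) (d : ℕ → ℕ) (n : ℕ) :
    shiftedStandardSeq a b d (n + 2) =
      (List.replicate (d n) (shiftedStandardSeq a b d (n + 1))).flatten ++
        shiftedStandardSeq a b d n := rfl

theorem endLetters_succ (a b : A) (n : ℕ) : endLetters a b (n + 1) = (endLetters a b n).swap := by
  unfold endLetters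
  by_cases h : Odd n
  · have : ¬ Odd (n + 1) := by simpa [Nat.odd_add_one] using h
    simp [h, this]
  · have : Odd (n + 1) := by simpa [Nat.odd_add_one] using h
    simp [h, this]

theorem append_flatten_replicate (l : List A) (m : ℕ) :
    l ++ (List.replicate m l).flatten = (List.replicate m l).flatten ++ l := by
  rw [← List.flatten_cons, ← List.replicate_succ, List.replicate_succ']
  simp

/-- Two consecutive standard words commute up to the order of the last two letters. -/
theorem standardSeq_near_commute (a b : A) (d : ℕ → ℕ) (n : ℕ) :
    ∃ t : List A,
      standardSeq a b d (n + 1) ++ standardSeq a b d n =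
        t ++ [(endLetters a b n).1, (endLetters a b n).2] ∧
      standardSeq a b d n ++ standardSeq a b d (n + 1) =
        t ++ [(endLetters a b n).2, (endLetters a b n).1] := by
  induction n with
  | zero =>
    refine ⟨(List.replicate (d 0) [a]).flatten, ?_, ?_⟩
    · simp [standardSeq, shiftedStandardSeq, endLetters]
    · simp only [standardSeq, shiftedStandardSeq, endLetters, ← List.append_assoc]
      rw [append_flatten_replicate]
      simp
  | succ n ih =>
    obtain ⟨t, h₁, h₂⟩ := ih
    have hs : standardSeq a b d (n + 2) =
      (List.replicate (d (n + 1)) (standardSeq a b d (n + 1))).flatten ++ standardSeq a b d n := rfl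
    -- Both products start with `s_{n+1} ^ d (n + 1)`; what remains is `s_n s_{n+1}` and `s_{n+1}
    -- s_n`, so the end letters swap.
    refine ⟨(List.replicate (d (n + 1)) (standardSeq a b d (n + 1))).flatten ++ t, ?_, ?_⟩
    · rw [hs, List.append_assoc, h₂, endLetters_succ]
      simp
    · rw [hs, ← List.append_assoc, append_flatten_replicate, List.append_assoc, h₁,
        endLetters_succ]
      simp

theorem standardSeq_succ_eq (hd : ∀ n, 0 < d n) (n : ℕ) :
    ∃ l, standardSeq a b d (n + 1) = standardSeq a b d n ++ l ∧ l ≠ [] := by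
  have hne : ∀ n, shiftedStandardSeq a b d n ≠ [] := by
    intro n
    induction n using Nat.twoStepInduction with
    | zero => simp [shiftedStandardSeq]
    | one => simp [shiftedStandardSeq]
    | more n ih _ => simp [shiftedStandardSeq_add_two, ih]
  obtain ⟨e, he⟩ : ∃ e, d n = e + 1 := ⟨d n - 1, by have := hd n; omega⟩
  refine ⟨(List.replicate e (standardSeq a b d n)).flatten ++ shiftedStandardSeq a b d n, ?_, ?_⟩
  · rw [standardSeq, shiftedStandardSeq_add_two, he, List.replicate_succ]
    simp [standardSeq]
  · simp [hne]

theorem standardSeq_prefix_succ (hd : ∀ n, 0 < d n) (n : ℕ) :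
    standardSeq a b d n <+: standardSeq a b d (n + 1) := by
  obtain ⟨l, h, -⟩ := standardSeq_succ_eq (a := a) (b := b) hd n
  exact ⟨l, h.symm⟩

theorem strictMono_length_standardSeq (hd : ∀ n, 0 < d n) :
    StrictMono fun n => (standardSeq a b d n).length := by
  refine strictMono_nat_of_lt_succ fun n => ?_
  obtain ⟨l, h, hl⟩ := standardSeq_succ_eq (a := a) (b := b) hd n
  have := List.length_pos_iff.2 hl
  simp only [h, List.length_append]
  omega

theorem standardSeq_prefix_of_le (hd : ∀ n, 0 < d n) {m n : ℕ} (h : m ≤ n) :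
    standardSeq a b d m <+: standardSeq a b d n := by
  induction n, h using Nat.le_induction with
  | base => exact List.prefix_rfl
  | succ n _ ih => exact ih.trans (standardSeq_prefix_succ hd n)

theorem standardSeq_append_prefix (hd : ∀ n, 0 < d n) (n : ℕ) :
    standardSeq a b d (n + 1) ++ standardSeq a b d n <+: standardSeq a b d (n + 2) := by
  have hs : standardSeq a b d (n + 2) =
    (List.replicate (d (n + 1)) (standardSeq a b d (n + 1))).flatten ++ standardSeq a b d n := rfl
  have := hd (n + 1)
  rw [hs]
  match h : d (n + 1) with
  | 0 => omega
  | 1 => simp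
  | e + 2 =>
    rw [List.replicate_succ, List.replicate_succ, List.flatten_cons, List.flatten_cons,
      List.append_assoc, List.append_assoc, List.prefix_append_right_inj]
    exact (standardSeq_prefix_succ hd n).trans (List.prefix_append _ _)

/-- For `n ≥ 1` the word `s_n` ends with the two letters `endLetters a b n`. -/
theorem standardSeq_eq_append_endLetters (hd : ∀ n, 0 < d n) (n : ℕ) (hn : 1 ≤ n) :
    ∃ t, standardSeq a b d n = t ++ [(endLetters a b n).1, (endLetters a b n).2] := by
  obtain ⟨m, rfl⟩ : ∃ m, n = m + 1 := ⟨n - 1, by omega⟩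
  clear hn
  induction m using Nat.twoStepInduction with
  | zero =>
    obtain ⟨e, he⟩ : ∃ e, d 0 = e + 1 := ⟨d 0 - 1, by have := hd 0; omega⟩
    refine ⟨(List.replicate e [a]).flatten, ?_⟩
    rw [standardSeq, shiftedStandardSeq_add_two, he, List.replicate_succ']
    simp [shiftedStandardSeq, endLetters]
  | one =>
    obtain ⟨e, he⟩ : ∃ e, d 1 = e + 1 := ⟨d 1 - 1, by have := hd 1; omega⟩
    refine ⟨(List.replicate e (standardSeq a b d 1)).flatten ++
      (List.replicate (d 0) [a]).flatten, ?_⟩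
    rw [standardSeq, shiftedStandardSeq_add_two, he, List.replicate_succ', List.flatten_concat]
    simp [standardSeq, shiftedStandardSeq, endLetters, show ¬ Odd 2 by decide]
  | more m ih _ =>
    obtain ⟨t, ht⟩ := ih
    have hs : standardSeq a b d (m + 2 + 1) = (List.replicate (d (m + 2))
      (standardSeq a b d (m + 2))).flatten ++ standardSeq a b d (m + 1) := rfl
    refine ⟨(List.replicate (d (m + 2)) (standardSeq a b d (m + 2))).flatten ++ t, ?_⟩
    rw [hs, ht, endLetters_succ a b (m + 2), endLetters_succ a b (m + 1), Prod.swap_swap,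
      List.append_assoc]

/-- The determinant of lengths and `a`-counts of consecutive words changes sign at each step of the
recurrence, so it stays `±1` and is a Bézout relation. -/
theorem coprime_length_count [DecidableEq A] (hab : a ≠ b) (d : ℕ → ℕ) (n : ℕ) :
    Nat.Coprime (standardSeq a b d n).length ((standardSeq a b d n).count a) := by
  have key : ∀ n, ((shiftedStandardSeq a b d (n + 1)).length : ℤ) *
        (shiftedStandardSeq a b d n).count a -
      (shiftedStandardSeq a b d n).length * (shiftedStandardSeq a b d (n + 1)).count a =
        -(-1) ^ n := by
    intro n
    induction n with
    | zero => simp [shiftedStandardSeq, hab.symm]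
    | succ n ih =>
      simp only [shiftedStandardSeq_add_two, List.length_append, List.count_append,
        List.length_flatten, List.map_replicate, List.sum_replicate, List.count_flatten,
        smul_eq_mul, Nat.cast_add, Nat.cast_mul]
      rw [pow_succ]
      linear_combination -ih
  have h := key n
  rw [← Nat.isCoprime_iff_coprime]
  rcases neg_one_pow_eq_or ℤ n with h1 | h1
  · exact ⟨-(shiftedStandardSeq a b d n).count a, (shiftedStandardSeq a b d n).length,
      by rw [standardSeq]; rw [h1] at h; linear_combination -h⟩
  · exact ⟨(shiftedStandardSeq a b d n).count a, -(shiftedStandardSeq a b d n).length,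
      by rw [standardSeq]; rw [h1] at h; linear_combination h⟩

end StandardSequence

/-! ### First returns and closed lengths in `w` -/

section StandardWord

variable {A : Type*} {a b : A} {d : ℕ → ℕ} {w : ℕ → A}

theorem standardSeq_isPrefixOfInfinite (hd : ∀ n, 0 < d n)
    (hw : WordsConvergeTo (standardSeq a b d) w) (n : ℕ) :
    IsPrefixOfInfinite (standardSeq a b d n) w := by
  intro i hi
  obtain ⟨N, hN⟩ := hw i
  have h := hN (max N n) (le_max_left _ _)
  have hp := standardSeq_prefix_of_le (a := a) (b := b) hd (le_max_right N n)
  rw [hp.getElem hi]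
  exact (List.getElem_eq_iff _).2 h

theorem standardSeq_append_isPrefixOfInfinite (hd : ∀ n, 0 < d n)
    (hw : WordsConvergeTo (standardSeq a b d) w) (n : ℕ) :
    IsPrefixOfInfinite (standardSeq a b d (n + 1) ++ standardSeq a b d n) w :=
  (standardSeq_isPrefixOfInfinite hd hw (n + 2)).of_prefix (standardSeq_append_prefix hd n)

/-- The prefix of length `|s_{n+1}| - 2` of `w` recurs at position `|s_n|`. -/
theorem prefixOccursAt_length_standardSeq (hd : ∀ n, 0 < d n)
    (hw : WordsConvergeTo (standardSeq a b d) w) (n : ℕ) {k : ℕ}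
    (hk : k + 2 ≤ (standardSeq a b d (n + 1)).length) :
    PrefixOccursAt w k (standardSeq a b d n).length := by
  intro j hj
  obtain ⟨t, h₁, h₂⟩ := standardSeq_near_commute a b d n
  have hlen := congrArg List.length h₂
  simp only [List.length_append, List.length_cons, List.length_nil] at hlen
  have hpre := standardSeq_append_isPrefixOfInfinite hd hw n
  rw [h₁] at hpre
  have ht := hpre.of_prefix (List.prefix_append _ _)
  rw [← ht (_ + j) (by omega), ← standardSeq_isPrefixOfInfinite hd hw (n + 1) j (by omega)]
  -- This position is letter `j` of `s_{n+1}`, and the bound on `k` keeps it inside the common part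
  -- `t`, which is a prefix of `w`.
  have := congrArg (fun l => l[(standardSeq a b d n).length + j]?) h₂
  rw [List.getElem?_append_right (by omega), List.getElem?_append_left (by omega),
    Nat.add_sub_cancel_left, List.getElem?_eq_getElem (by omega),
    List.getElem?_eq_getElem (by omega)] at this
  exact (Option.some.inj this).symm

/-- The prefix of length `|s_n| - 1` of `w` does not recur before position `|s_n|`. -/
theorem not_prefixOccursAt_of_lt (hab : a ≠ b) (hd : ∀ n, 0 < d n)
    (hw : WordsConvergeTo (standardSeq a b d) w) (n : ℕ) {k i : ℕ}
    (hk : (standardSeq a b d n).length ≤ k + 1) (hi : 0 < i)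
    (hin : i < (standardSeq a b d n).length) : ¬ PrefixOccursAt w k i := by
  classical
  intro hocc
  set q := (standardSeq a b d n).length with hq
  have hqq : q < (standardSeq a b d (n + 1)).length :=
    strictMono_length_standardSeq hd (Nat.lt_succ_self n)
  have hret := prefixOccursAt_length_standardSeq hd hw n (k := q - 1) (by omega)
  -- Indicator of `a` in the periodic repetition of `s_n`, which agrees with `w` on the first `2 * q
  -- - 1` places.
  let c : ℕ → ℕ := fun j => if w (j % q) = a then 1 else 0
  have hmod : ∀ j, j + 1 < 2 * q → w (j % q) = w j := by
    intro j hj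
    by_cases h : j < q
    · rw [Nat.mod_eq_of_lt h]
    · rw [Nat.mod_eq_sub_mod (by omega), Nat.mod_eq_of_lt (by omega),
        ← hret (j - q) (by omega)]
      congr 1
      omega
  have hsum : ∑ j ∈ Finset.range q, c j = (standardSeq a b d n).count a := by
    have hs := (standardSeq_isPrefixOfInfinite hd hw n).eq_infinitePrefix
    rw [← hq] at hs
    rw [hs, infinitePrefix, List.count, List.countP_map, List.countP_eq_length_filter]
    rw [Finset.sum_congr rfl (g := fun j => if w j = a then 1 else 0)
      (fun j hj => by simp only [c]; rw [Nat.mod_eq_of_lt (by simpa using hj)])]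
    rw [← Finset.card_filter]
    rfl
  refine Nat.not_dvd_of_pos_of_lt hi hin
    (dvd_shift_of_coprime_sum (c := c) (by omega) (fun j => by simp [c]) ?_ fun j hj => ?_)
  · rw [hsum]
    exact coprime_length_count hab d n
  · simp only [c]
    rw [hmod _ (by omega), hmod j (by omega), add_comm, hocc j (by omega)]

/-- The lengths of the closed prefixes of a standard Sturmian word. -/
theorem isClosedWord_infinitePrefix_standard_iff (hab : a ≠ b) (hd : ∀ n, 0 < d n)
    (hw : WordsConvergeTo (standardSeq a b d) w) (L : ℕ) :
    IsClosedWord (infinitePrefix w L) ↔ L = 0 ∨ ∃ n,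
      2 * (standardSeq a b d n).length ≤ L + 1 ∧
      L + 2 ≤ (standardSeq a b d n).length + (standardSeq a b d (n + 1)).length := by
  rw [isClosedWord_infinitePrefix_iff]
  have hmono := strictMono_length_standardSeq (a := a) (b := b) hd
  have h0 : (standardSeq a b d 0).length = 1 := rfl
  have hret : ∀ n k, (standardSeq a b d n).length ≤ k + 1 →
      k + 2 ≤ (standardSeq a b d (n + 1)).length →
      PrefixOccursAt w k (standardSeq a b d n).length ∧
      ∀ i, 0 < i → i < (standardSeq a b d n).length → ¬ PrefixOccursAt w k i :=
    fun n k h₁ h₂ => ⟨prefixOccursAt_length_standardSeq hd hw n h₂,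
      fun i hi hin => not_prefixOccursAt_of_lt hab hd hw n h₁ hi hin⟩
  refine or_congr Iff.rfl ⟨?_, ?_⟩
  · rintro ⟨k, r, rfl, hr, hocc, hfirst⟩
    obtain ⟨n, hn₁, hn₂⟩ : ∃ n, (standardSeq a b d n).length ≤ k + 1 ∧
        k + 2 ≤ (standardSeq a b d (n + 1)).length := by
      -- The least such `m` is positive because `|s_0| = 1`; its predecessor is the required `n`.
      have hex : ∃ m, k + 2 ≤ (standardSeq a b d m).length := ⟨k + 2, hmono.id_le (k + 2)⟩
      have hspec := Nat.find_spec hex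
      have hmin := fun m => Nat.find_min hex (m := m)
      generalize Nat.find hex = m at hspec hmin
      cases m with
      | zero => omega
      | succ m => exact ⟨m, by have := hmin m (by omega); omega, hspec⟩
    obtain ⟨h₁, h₂⟩ := hret n k hn₁ hn₂
    have hpos : 0 < (standardSeq a b d n).length := by
      have : (standardSeq a b d 0).length ≤ (standardSeq a b d n).length :=
        hmono.monotone (Nat.zero_le n)
      omega
    have : r = (standardSeq a b d n).length := by
      rcases lt_trichotomy r (standardSeq a b d n).length with h | h | h
      · exact absurd hocc (h₂ r hr h)
      · exact h
      · exact absurd h₁ (hfirst _ hpos h)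
    exact ⟨n, by omega, by omega⟩
  · rintro ⟨n, hn₁, hn₂⟩
    have hpos : 0 < (standardSeq a b d n).length := by
      have : (standardSeq a b d 0).length ≤ (standardSeq a b d n).length :=
        hmono.monotone (Nat.zero_le n)
      omega
    obtain ⟨h₁, h₂⟩ := hret n (L - (standardSeq a b d n).length) (by omega) (by omega)
    exact ⟨_, _, by omega, hpos, h₁, h₂⟩

end StandardWord

/-! ### Exponent sums in the free group -/

section FreeGroupLength

variable {A : Type*}

/-- The exponent sum of an element of the free group. -/
def exponentSum (A : Type*) : FreeGroup A →* Multiplicative ℤ :=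
  FreeGroup.lift fun _ => Multiplicative.ofAdd 1

theorem exponentSum_of (x : A) : exponentSum A (FreeGroup.of x) = Multiplicative.ofAdd 1 := by
  simp [exponentSum]

theorem exponentSum_wordInFreeGroup (v : List A) :
    exponentSum A (wordInFreeGroup v) = Multiplicative.ofAdd (v.length : ℤ) := by
  induction v with
  | nil => simp [wordInFreeGroup]
  | cons x v ih =>
    have : wordInFreeGroup (x :: v) = FreeGroup.of x * wordInFreeGroup v := by
      simp [wordInFreeGroup]
    rw [this, map_mul, ih, exponentSum_of, ← ofAdd_add]
    congr 1
    push_cast [List.length_cons]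
    ring

/-- The value is taken in `ℤ`: it is `-1` at `n = 0`, where `u_0 = b⁻¹`. -/
theorem exponentSum_centralSeq (a b : A) (d : ℕ → ℕ) (n : ℕ) :
    exponentSum A (centralSeq a b d n) =
      Multiplicative.ofAdd (((standardSeq a b d n).length : ℤ) - 2) := by
  rw [centralSeq, map_mul, map_inv, map_mul, exponentSum_of, exponentSum_of,
    exponentSum_wordInFreeGroup, ← ofAdd_add, ← ofAdd_neg, ← ofAdd_add]
  congr 1

theorem wordInFreeGroup_append (u v : List A) :
    wordInFreeGroup (u ++ v) = wordInFreeGroup u * wordInFreeGroup v := by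
  simp [wordInFreeGroup]

theorem wordInFreeGroup_pair (x y : A) :
    wordInFreeGroup [x, y] = FreeGroup.of x * FreeGroup.of y := by
  simp [wordInFreeGroup]

end FreeGroupLength

/-! ### Transitions between open and closed prefixes -/

theorem mainTheorem3 {A : Type*} (a b : A) (hab : a ≠ b) (α : ℝ) (d : ℕ → ℕ) (w : ℕ → A)
    (hw : IsStandardSturmian a b α d w) (hd : 0 < d 0)
    (v : List A) (x : A) (hvx : IsPrefixOfInfinite (v ++ [x]) w) :
    ((IsOpenWord v ∧ IsClosedWord (v ++ [x])) ↔
      ∃ n : ℕ, 1 ≤ n ∧ ∃ y : A, (x, y) = endLetters a b n ∧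
        wordInFreeGroup v =
          centralSeq a b d n * FreeGroup.of x * FreeGroup.of y * centralSeq a b d n) ∧
    ((IsClosedWord v ∧ IsOpenWord (v ++ [x])) ↔
      ∃ n : ℕ, ∃ y : A, (x, y) = endLetters a b n ∧
        wordInFreeGroup v =
          centralSeq a b d n * FreeGroup.of x * FreeGroup.of y * centralSeq a b d (n + 1) ∧
        wordInFreeGroup v =
          centralSeq a b d (n + 1) * FreeGroup.of y * FreeGroup.of x * centralSeq a b d n) := by
  have hdpos := hw.expansion.pos hd
  have hconv := hw.converges
  have hmono := strictMono_length_standardSeq (a := a) (b := b) hdpos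
  have h0 : (standardSeq a b d 0).length = 1 := rfl
  have hclosed := isClosedWord_infinitePrefix_standard_iff hab hdpos hconv
  have hv := hvx.of_prefix (List.prefix_append v [x])
  have hlen : (v ++ [x]).length = v.length + 1 := by simp
  have hcv := hclosed v.length
  have hcvx := hclosed (v.length + 1)
  rw [← hv.eq_infinitePrefix] at hcv
  rw [← hlen, ← hvx.eq_infinitePrefix, hlen] at hcvx
  unfold IsOpenWord
  rw [hcv, hcvx]
  have hlt : ∀ m n, m < n → (standardSeq a b d m).length < (standardSeq a b d n).length :=
    fun m n h => hmono h
  have hle : ∀ m n, m ≤ n → (standardSeq a b d m).length ≤ (standardSeq a b d n).length :=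
    fun m n h => hmono.monotone h
  constructor
  · have key : (∃ n, 1 ≤ n ∧ v.length + 2 = 2 * (standardSeq a b d n).length) ↔
        ∃ n : ℕ, 1 ≤ n ∧ ∃ y : A, (x, y) = endLetters a b n ∧
        wordInFreeGroup v =
          centralSeq a b d n * FreeGroup.of x * FreeGroup.of y * centralSeq a b d n := by
      refine exists_congr fun n => and_congr_right fun hn => ⟨fun h => ?_, ?_⟩
      · obtain ⟨t, ht⟩ := standardSeq_eq_append_endLetters (a := a) (b := b) hdpos n hn
        have htl : (standardSeq a b d n).length = t.length + 2 := by simp [ht]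
        -- With `s_n = t x y`, the prefix `t x` recurs at position `|s_n|`, so `v x = s_n t x` and
        -- `u_n = t`.
        have hpre : IsPrefixOfInfinite
            (standardSeq a b d n ++ t ++ [(endLetters a b n).1]) w := by
          have hsn := standardSeq_isPrefixOfInfinite hdpos hconv n
          have htx : IsPrefixOfInfinite (t ++ [(endLetters a b n).1]) w :=
            hsn.of_prefix (by simp [ht])
          have hret := prefixOccursAt_length_standardSeq hdpos hconv n (k := t.length + 1)
            (by have := hlt n (n + 1) (by omega); omega)
          intro i hi
          simp only [List.append_assoc]
          by_cases hin : i < (standardSeq a b d n).length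
          · rw [List.getElem_append_left hin, hsn i hin]
          · have hi' : i - (standardSeq a b d n).length < t.length + 1 := by
              simp at hi
              omega
            rw [List.getElem_append_right (by omega), htx _ (by simpa using hi'), ← hret _ hi']
            congr 1
            omega
        have heq := hvx.eq_of_length_eq hpre (by simp; omega)
        obtain ⟨h₁, h₂⟩ := List.append_inj' heq rfl
        obtain rfl : x = (endLetters a b n).1 := by simpa using h₂
        refine ⟨(endLetters a b n).2, rfl, ?_⟩
        have hc : centralSeq a b d n = wordInFreeGroup t := by
          rw [centralSeq, ht, wordInFreeGroup_append, wordInFreeGroup_pair, mul_inv_cancel_right]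
        rw [h₁, hc, ht, wordInFreeGroup_append, wordInFreeGroup_append, wordInFreeGroup_pair]
        simp only [mul_assoc]
      · rintro ⟨y, -, h⟩
        have := congrArg (exponentSum A) h
        simp only [map_mul, exponentSum_of, exponentSum_centralSeq,
          exponentSum_wordInFreeGroup, ← ofAdd_add] at this
        have := Multiplicative.ofAdd.injective this
        omega
    rw [← key]
    constructor
    · rintro ⟨h₁, h₂⟩
      push Not at h₁
      obtain ⟨n, hn₁, hn₂⟩ := h₂.resolve_left (by omega)
      have := h₁.2 n
      refine ⟨n, ?_, by omega⟩
      -- For `n = 0` the interval starts at length `1`, but then `v` is empty and hence closed.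
      by_contra hn
      obtain rfl : n = 0 := by omega
      omega
    · rintro ⟨n, hn, h⟩
      have h₁ := hlt 0 n (by omega)
      have h₂ := hlt n (n + 1) (by omega)
      refine ⟨?_, Or.inr ⟨n, by omega, by omega⟩⟩
      rintro (h' | ⟨m, hm₁, hm₂⟩)
      · omega
      -- Earlier intervals end before length `2 q_n - 2`, later ones start after it.
      · rcases lt_or_ge m n with hmn | hmn
        · have := hle (m + 1) n hmn
          have := hlt m n hmn
          omega
        · have := hle n m hmn
          omega
  · have key : (∃ n, v.length + 2 =
          (standardSeq a b d n).length + (standardSeq a b d (n + 1)).length) ↔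
        ∃ n : ℕ, ∃ y : A, (x, y) = endLetters a b n ∧
        wordInFreeGroup v =
          centralSeq a b d n * FreeGroup.of x * FreeGroup.of y * centralSeq a b d (n + 1) ∧
        wordInFreeGroup v =
          centralSeq a b d (n + 1) * FreeGroup.of y * FreeGroup.of x * centralSeq a b d n := by
      refine exists_congr fun n => ⟨fun h => ?_, ?_⟩
      · obtain ⟨t, ht₁, ht₂⟩ := standardSeq_near_commute a b d n
        have hpre := standardSeq_append_isPrefixOfInfinite hdpos hconv n
        have htl := congrArg List.length ht₁
        simp only [List.length_append, List.length_cons, List.length_nil] at htl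
        rw [ht₁] at hpre
        have hpre' : IsPrefixOfInfinite (t ++ [(endLetters a b n).1]) w :=
          hpre.of_prefix (by simp)
        have heq := hvx.eq_of_length_eq hpre' (by simp; omega)
        obtain ⟨h₁, h₂⟩ := List.append_inj' heq rfl
        obtain rfl : x = (endLetters a b n).1 := by simpa using h₂
        have g₁ := congrArg wordInFreeGroup ht₁
        have g₂ := congrArg wordInFreeGroup ht₂
        rw [wordInFreeGroup_append, wordInFreeGroup_append, wordInFreeGroup_pair] at g₁ g₂
        have g₁' := eq_mul_inv_of_mul_eq g₁.symm
        have g₂' := eq_mul_inv_of_mul_eq g₂.symm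
        refine ⟨(endLetters a b n).2, rfl, ?_, ?_⟩
        · rw [h₁]
          simp only [centralSeq, endLetters_succ, Prod.fst_swap, Prod.snd_swap]
          -- `t` equals `s_n s_{n+1} (yx)⁻¹`, and `(yx)⁻¹` is the factor that turns `s_{n+1}` into
          -- `u_{n+1}`; this needs no case split at `n = 0`.
          rw [g₂']
          group
        · rw [h₁]
          simp only [centralSeq, endLetters_succ, Prod.fst_swap, Prod.snd_swap]
          rw [g₁']
          group
      · rintro ⟨y, -, -, h⟩
        have := congrArg (exponentSum A) h
        simp only [map_mul, exponentSum_of, exponentSum_centralSeq,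
          exponentSum_wordInFreeGroup, ← ofAdd_add] at this
        have := Multiplicative.ofAdd.injective this
        omega
    rw [← key]
    constructor
    · rintro ⟨h₁, h₂⟩
      push Not at h₂
      rcases h₁ with h₁ | ⟨n, hn₁, hn₂⟩
      -- If `v` is empty, `v x` is a single letter, which is closed by the interval `n = 0`.
      · have h₃ := h₂.2 0 (by omega)
        have := hlt 0 (0 + 1) (by omega)
        omega
      · have := h₂.2 n (by omega)
        exact ⟨n, by omega⟩
    · rintro ⟨n, h⟩
      have h₂ := hlt n (n + 1) (by omega)
      refine ⟨Or.inr ⟨n, by omega, by omega⟩, ?_⟩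
      rintro (h' | ⟨m, hm₁, hm₂⟩)
      · omega
      · rcases lt_or_ge n m with hmn | hmn
        · have := hle (n + 1) m hmn
          omega
        · have := hle m n hmn
          have := hle (m + 1) (n + 1) (by omega)
          omega
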